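/- Identify $\mathbb R^2$ with $\mathbb C$. Let $a>0$, $g\in\mathbb R\setminus\{0\}$, $\mu\in\mathbb R$. Let $\Sigma$ be the logarithmic spiral parametrized by $Z(\theta)=e^{(a+i)\theta}$, $\theta\in\mathbb R$, and oriented by increasing $\theta$, with unit tangent $\vec\tau(Z(\theta))=\frac{a+i}{\sqrt{a^2+1}}e^{i\theta}$ and unit normal $\vec n=-i\vec\tau$, and let $\gamma(Z(\theta))=\frac{2ag}{\sqrt{1+a^2}}e^{a\theta}$. Consider locally integrable planar fields $w=w_1+iw_2$ on $\mathbb C$ (fields equal almost everywhere are identified) such that 1. $\operatorname{div} w=0$ in the sense of distributions on $\mathbb R^2$; 2. $\operatorname{curl} w=\partial_1w_2-\partial_2w_1=\gamma\,\delta_\Sigma$ in the sense of distributions on $\mathbb R^2$, where $\langle\gamma\delta_\Sigma,\varphi\rangle=\int_\Sigma\gamma\varphi\,ds=\int_{\mathbb R}\gamma(Z(\theta))\varphi(Z(\theta))|Z'(\theta)|\,d\theta$; 3. (velocity matching) $\vec n(z)\cdot(w(z)-\mu z)=0$ for $z\in\Sigma$, in the sense that the limits of $\vec n(z)\cdot w(z')$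 as $z'\to z$ from the left and from the right side of $\Sigma$ both exist and equal $\vec n(z)\cdot\mu z$; 4. (decay) $|w(z)|\lesssim|z|$ as $z\to0$. Then there is at most one such field: any two fields with properties 1–4 (for the same $a,g,\mu$) coincide. If, moreover, $$2ag\sin\Big(\frac{4\pi a^2}{1+a^2}\Big)=\mu\Big(2\cos\Big(\frac{4\pi a^2}{1+a^2}\Big)-e^{-\frac{4\pi a}{1+a^2}}-e^{\frac{4\pi a}{1+a^2}}\Big),$$ then every field $w$ with properties 1–4 is given, for $z=re^{i\theta}\in\mathbb C\setminus(\Sigma\cup\{0\})$ with $r>0$, $\theta\in\mathbb R$, by $$w(z)=e^{i\theta}\,\frac{2ag}{r(a-i)}\left(r^{\frac{2a}{a+i}}e^{-A\theta}\,\frac{e^{2\pi J(r,\theta)A}}{1-e^{2\pi A}}\right)^{*},$$ where ${}^*$ is complex conjugation, $A=-\frac{2ai}{a+i}$ and $J(r,\theta)=\min\{j\in\mathbb Z: a(2\pi j-\theta)+\ln r>0\}$. -/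

import Mathlib

open MeasureTheory Filter Topology
open scoped ContDiff ComplexConjugate

noncomputable section

namespace PrandtlSpiral

/-! The plane is identified with `ℂ`; a planar field `w = (w₁, w₂)` is `w = w₁ + i w₂`. -/

/-- The logarithmic spiral `Z(θ) = e^{(a+i)θ}`. -/
def Z (a θ : ℝ) : ℂ := Complex.exp ((a + Complex.I) * θ)

/-- The unit tangent `τ(Z(θ)) = (a + i) e^{iθ} / √(a² + 1)` of the spiral, oriented by
increasing `θ`. -/
def tangent (a θ : ℝ) : ℂ :=
  (a + Complex.I) / (Real.sqrt (a ^ 2 + 1) : ℂ) * Complex.exp (θ * Complex.I)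

/-- The unit normal `n = -iτ`; it points to the right of the oriented spiral. -/
def normal (a θ : ℝ) : ℂ := -Complex.I * tangent a θ

/-- The vortex sheet strength `γ(Z(θ)) = Γ'(θ) / |Z'(θ)| = 2ag e^{aθ} / √(1 + a²)`, where
`Γ(θ) = g e^{2aθ}` is the circulation. -/
def sheetDensity (a g θ : ℝ) : ℝ := 2 * a * g / Real.sqrt (1 + a ^ 2) * Real.exp (a * θ)

/-- The distribution `γ δ_Σ`, i.e. `φ ↦ ∫_Σ γ φ ds`, with `ds = |Z'(θ)| dθ` the arc length of
the spiral `Σ` (which is parametrized injectively by `Z` when `a ≠ 0`). -/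
def sheetPairing (a g : ℝ) (φ : ℂ → ℝ) : ℝ :=
  ∫ θ : ℝ, sheetDensity a g θ * φ (Z a θ) * ‖deriv (Z a) θ‖

/-- Test functions: real-valued, smooth and compactly supported on the whole plane. -/
def IsTest (φ : ℂ → ℝ) : Prop := ContDiff ℝ ∞ φ ∧ HasCompactSupport φ

/-- `∂₁w₁ + ∂₂w₂ = 0` in the sense of distributions on the plane. -/
def WeaklyDivFree (w : ℂ → ℂ) : Prop :=
  ∀ φ : ℂ → ℝ, IsTest φ →
    ∫ z : ℂ, ((w z).re * fderiv ℝ φ z 1 + (w z).im * fderiv ℝ φ z Complex.I) = 0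

/-- `curl w = ∂₁w₂ - ∂₂w₁ = γ δ_Σ` in the sense of distributions on the plane. -/
def WeakCurlEqSheet (a g : ℝ) (w : ℂ → ℂ) : Prop :=
  ∀ φ : ℂ → ℝ, IsTest φ →
    ∫ z : ℂ, ((w z).re * fderiv ℝ φ z Complex.I - (w z).im * fderiv ℝ φ z 1)
      = sheetPairing a g φ

/-- `z' → Z(θ)` from the right of the spiral: `z' = e^s Z(t)` with `s → 0⁺` and `t → θ`.
As the spiral winds counterclockwise and outwards (`a > 0`), its right side is the outer one,
and `(s, t) ↦ e^s Z(t)` is a local diffeomorphism carrying `{s = 0}` to the spiral. -/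
def rightOf (a θ : ℝ) : Filter ℂ :=
  Filter.map (fun p : ℝ × ℝ => Complex.exp p.1 * Z a p.2) (𝓝[>] (0 : ℝ) ×ˢ 𝓝 θ)

/-- `z' → Z(θ)` from the left (inner) side of the spiral. -/
def leftOf (a θ : ℝ) : Filter ℂ :=
  Filter.map (fun p : ℝ × ℝ => Complex.exp p.1 * Z a p.2) (𝓝[<] (0 : ℝ) ×ˢ 𝓝 θ)

/-- Velocity matching `n(z) · (w(z) - μ z) = 0` on the spiral: at every point `z = Z(θ)` the
one-sided limits of the normal component, `n · w^L` and `n · w^R`, both equal `n · (μ z)`.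
(Limits along `ae volume` disregard null sets of `z'`, as `w` is defined almost everywhere.) -/
def VelocityMatching (a μ : ℝ) (w : ℂ → ℂ) : Prop :=
  ∀ θ : ℝ,
    Tendsto (fun z => inner ℝ (normal a θ) (w z)) (leftOf a θ ⊓ ae volume)
      (𝓝 (inner ℝ (normal a θ) ((μ : ℂ) * Z a θ))) ∧
    Tendsto (fun z => inner ℝ (normal a θ) (w z)) (rightOf a θ ⊓ ae volume)
      (𝓝 (inner ℝ (normal a θ) ((μ : ℂ) * Z a θ)))

/-- `|w(z)| ≲ |z|` as `z → 0` (up to null sets; the spiral and the origin are null sets). -/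
def DecayAtOrigin (w : ℂ → ℂ) : Prop :=
  w =O[𝓝 (0 : ℂ) ⊓ ae volume] fun z => z

/-- The class of velocity profiles under consideration. All conditions are insensitive to
changing `w` on a null set. -/
structure IsSpiralVelocity (a g μ : ℝ) (w : ℂ → ℂ) : Prop where
  locallyIntegrable : LocallyIntegrable w volume
  divFree : WeaklyDivFree w
  curl_eq : WeakCurlEqSheet a g w
  matching : VelocityMatching a μ w
  decay : DecayAtOrigin w

/-- The winding number `J(r,θ) = min {j ∈ ℤ | a(2πj - θ) + ln r > 0}` (the set is nonempty and
bounded below if `a > 0`, and then `sInf` is its minimum). -/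
def windingJ (a r θ : ℝ) : ℤ :=
  sInf {j : ℤ | 0 < a * (2 * Real.pi * j - θ) + Real.log r}

/-- The exponent `A = -2ai / (a + i)`. -/
def expA (a : ℝ) : ℂ := -2 * a * Complex.I / (a + Complex.I)

/-- The Prandtl profile in polar coordinates,
`e^{iθ} (2ag / (r(a-i))) (r^{2a/(a+i)} e^{-Aθ} e^{2πJ(r,θ)A} / (1 - e^{2πA}))^*`. -/
def prandtlProfile (a g r θ : ℝ) : ℂ :=
  Complex.exp (θ * Complex.I) * (2 * a * g / (r * (a - Complex.I))) *
    conj ((r : ℂ) ^ (2 * a / (a + Complex.I) : ℂ) * Complex.exp (-expA a * θ) *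
      (Complex.exp (2 * Real.pi * windingJ a r θ * expA a) /
        (1 - Complex.exp (2 * Real.pi * expA a))))

/-- The pressure matching relation between the spiral parameters. -/
def PressureMatching (a g μ : ℝ) : Prop :=
  2 * a * g * Real.sin (4 * Real.pi * a ^ 2 / (1 + a ^ 2)) =
    μ * (2 * Real.cos (4 * Real.pi * a ^ 2 / (1 + a ^ 2))
      - Real.exp (-4 * Real.pi * a / (1 + a ^ 2)) - Real.exp (4 * Real.pi * a / (1 + a ^ 2)))

end PrandtlSpiral

end

noncomputable section

namespace PrandtlSpiral

open Complex ContinuousLinearMap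
open scoped Convolution

/-! Divergence and curl are the real and imaginary parts of one equation: both conditions say that
`conj w`, paired with `∂₁φ + i ∂₂φ`, gives `i⟨γδ_Σ, φ⟩` (`integral_conj_mul_dbar`).

Uniqueness: the sheet cancels in the difference of two fields, so the conjugate of the difference is
weakly holomorphic on the whole plane, origin included, and Weyl's lemma makes it an entire `F`.
Matching forces `Re(-i(a+i) e^{iθ} F(Z(θ))) = 0` for all `θ`. If `F ≠ 0`, write `F(z) = z^m G(z)`
near `0` with `G(0) ≠ 0`. Then `e^{iθ} Z(θ)^m` has argument `(m+1)θ`, which meets every phase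
infinitely often as the spiral winds into the origin. Hence `Re(-i(a+i) e^{iφ} G(0)) = 0` for every
`φ`, which is absurd (`eq_zero_of_inner_normal_eq_zero`).

Formula: by `ae_eq_of_matching` it suffices that the explicit profile solves the same equation and
matches on the spiral. Put `z = e^ζ` with `ζ = s + (a+i)t`. On the strip `0 < s ≤ 2πa` the conjugate
profile is a constant times `e^{(α-1)ζ}`, `α = 2a/(a+i)`. Both edges of the strip are mapped onto
`Σ`, with values differing by the monodromy `e^{2πA}`; the denominator `1 - e^{2πA}` turns that jump
into the density `γ` (`integral_conj_profileField_mul_dbar`). The pressure relation is exactly `2ag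
Im(1/(1 - e^{2πA})) = μ`, which is velocity matching (`PressureMatching.im_inv`). -/

/-- `∂̄f = 0` in the sense of distributions on the plane. -/
def WeaklyHolomorphic (f : ℂ → ℂ) : Prop :=
  ∀ φ : ℂ → ℝ, IsTest φ → ∫ z : ℂ, f z * (fderiv ℝ φ z 1 + I * fderiv ℝ φ z I) = 0

/-! ### Weyl's lemma for the Cauchy-Riemann operator -/

lemma IsTest.continuous_fderiv_apply {φ : ℂ → ℝ} (hφ : IsTest φ) (v : ℂ) :
    Continuous fun z => fderiv ℝ φ z v :=
  (hφ.1.continuous_fderiv (by simp)).clm_apply continuous_const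

lemma IsTest.hasCompactSupport_fderiv_apply {φ : ℂ → ℝ} (hφ : IsTest φ) (v : ℂ) :
    HasCompactSupport fun z => fderiv ℝ φ z v :=
  hφ.2.fderiv_apply ℝ v

lemma integrable_mul_fderiv {f : ℂ → ℂ} (hf : LocallyIntegrable f volume) {φ : ℂ → ℝ}
    (hφ : IsTest φ) (v : ℂ) : Integrable fun z => f z * fderiv ℝ φ z v := by
  have := hf.integrable_smul_left_of_hasCompactSupport (hφ.continuous_fderiv_apply v)
    (hφ.hasCompactSupport_fderiv_apply v)
  refine this.congr (ae_of_all _ fun z => ?_)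
  simp [mul_comm]

lemma IsTest.comp_sub_left {h : ℂ → ℝ} (hh : IsTest h) (x : ℂ) : IsTest fun t => h (x - t) :=
  ⟨hh.1.comp (contDiff_const.sub contDiff_id),
    hh.2.comp_homeomorph (Homeomorph.subLeft x)⟩

/-- Mollifying a weakly holomorphic function gives an entire function. -/
lemma WeaklyHolomorphic.differentiable_convolution {f : ℂ → ℂ} (hw : WeaklyHolomorphic f)
    (hf : LocallyIntegrable f volume) {h : ℂ → ℝ} (hh : IsTest h) :
    Differentiable ℂ (h ⋆[lsmul ℝ ℝ, volume] f) := by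
  intro x
  rw [← convolution_flip]
  have hd := hh.2.hasFDerivAt_convolution_right (lsmul ℝ ℝ).flip hf
    (hh.1.of_le (by simp)) x
  have hv : ∀ v, ((f ⋆[(lsmul ℝ ℝ).flip.precompR ℂ, volume] fderiv ℝ h) x) v =
      -∫ t, f t * fderiv ℝ (fun t => h (x - t)) t v := by
    intro v
    rw [convolution_precompR_apply _ hf (hh.2.fderiv ℝ) (hh.1.continuous_fderiv (by simp)),
      convolution_def, ← integral_neg]
    refine integral_congr_ae (ae_of_all _ fun t => ?_)
    have : fderiv ℝ (fun t => h (x - t)) t = -fderiv ℝ h (x - t) := by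
      have := ((hh.1.differentiable (by simp)).differentiableAt (x := x - t)).hasFDerivAt.comp t
        ((hasFDerivAt_id t).const_sub x)
      simpa [Function.comp_def] using this.fderiv
    simp [this, mul_comm]
  rw [differentiableAt_complex_iff_differentiableAt_real]
  refine ⟨hd.differentiableAt, ?_⟩
  rw [hd.fderiv, hv, hv]
  -- The weak equation tested on `t ↦ h (x - t)` is the Cauchy-Riemann equation of the mollification
  -- at `x`.
  have h0 := hw _ (hh.comp_sub_left x)
  have i1 := integrable_mul_fderiv hf (hh.comp_sub_left x) 1
  have i2 := integrable_mul_fderiv hf (hh.comp_sub_left x) I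
  have h1 : (∫ t, f t * fderiv ℝ (fun t => h (x - t)) t 1) +
      I * ∫ t, f t * fderiv ℝ (fun t => h (x - t)) t I = 0 := by
    rw [← h0, ← integral_const_mul, ← integral_add i1 (i2.const_mul I)]
    congr 1; ext t; ring
  rw [smul_eq_mul]
  linear_combination I * h1 - (∫ t, f t * fderiv ℝ (fun t => h (x - t)) t I) * I_sq

/-- The mean value property against a rotation invariant weight. -/
lemma integral_radial_smul {F : ℂ → ℂ} (hF : Differentiable ℂ F) {k : ℂ → ℝ} (hk : Continuous k)
    (hks : HasCompactSupport k) (hrot : ∀ (u : Circle) z, k (u * z) = k z) (x : ℂ) :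
    ∫ z, k z • F (x - z) = (∫ z, k z) • F x := by
  -- No rotation of `z` changes the integral, so it may be averaged over `θ`; after Fubini the inner
  -- integral is a circle mean of `F` about `x`.
  have hrotInt : ∀ θ : ℝ, ∫ z, k z • F (x - exp (θ * I) * z) = ∫ z, k z • F (x - z) := by
    intro θ
    symm
    rw [← (rotation (Circle.exp θ)).measurePreserving.integral_comp
      (rotation (Circle.exp θ)).toHomeomorph.measurableEmbedding]
    refine integral_congr_ae (ae_of_all _ fun z => ?_)
    simp [rotation_apply, ← hrot (Circle.exp θ) z]
  have hmean : ∀ z, ∫ θ in (0 : ℝ)..2 * Real.pi, F (x - exp (θ * I) * z)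
      = (2 * Real.pi) • F x := by
    intro z
    have hG : Differentiable ℂ fun u => F (x - u * z) := by fun_prop
    have := hG.diffContOnCl.circleAverage (c := (0 : ℂ)) (R := 1)
    simp only [Real.circleAverage_def, circleMap, zero_mul, sub_zero, ofReal_one, one_mul,
      zero_add] at this
    rw [← this, smul_inv_smul₀ (by positivity)]
  obtain ⟨C, hC⟩ : ∃ C, ∀ (θ : ℝ) z, ‖k z • F (x - exp (θ * I) * z)‖ ≤ C * ‖k z‖ := by
    obtain ⟨R, hR⟩ := hks.isCompact.isBounded.subset_closedBall 0
    obtain ⟨C, hC⟩ := (isCompact_closedBall x R).exists_bound_of_continuousOn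
      hF.continuous.continuousOn
    refine ⟨C, fun θ z => ?_⟩
    by_cases hz : k z = 0
    · simp [hz]
    · have hz' : z ∈ Metric.closedBall (0 : ℂ) R := hR (subset_tsupport _ hz)
      rw [norm_smul, mul_comm]
      gcongr
      refine hC _ ?_
      simpa [norm_exp_ofReal_mul_I] using hz'
  have hki : Integrable k := hk.integrable_of_hasCompactSupport hks
  have hint : Integrable (Function.uncurry fun (θ : ℝ) z => k z • F (x - exp (θ * I) * z))
      ((volume.restrict (Set.Ioc 0 (2 * Real.pi))).prod volume) := by
    refine Integrable.mono' ((hki.norm.const_mul C).comp_snd _) ?_ (ae_of_all _ ?_)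
    · have := hF.continuous
      exact Continuous.aestronglyMeasurable (by unfold Function.uncurry; fun_prop)
    · rintro ⟨θ, z⟩
      exact hC θ z
  have hswap := integral_integral_swap hint
  simp only [hrotInt, integral_smul] at hswap
  simp_rw [← intervalIntegral.integral_of_le (by positivity : (0 : ℝ) ≤ 2 * Real.pi), hmean,
    intervalIntegral.integral_const, sub_zero, smul_comm (k _), integral_smul,
    integral_smul_const] at hswap
  exact smul_right_injective _ (by positivity : (2 * Real.pi) ≠ 0) hswap

/-- In Weyl's lemma this exchanges the fixed radial mollifier with the shrinking ones. -/
lemma convolution_left_comm {h k : ℂ → ℝ} (hh : Continuous h) (hhs : HasCompactSupport h)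
    (hk : Continuous k) (hks : HasCompactSupport k) {f : ℂ → ℂ}
    (hf : LocallyIntegrable f volume) :
    h ⋆[lsmul ℝ ℝ, volume] (k ⋆[lsmul ℝ ℝ, volume] f) =
      k ⋆[lsmul ℝ ℝ, volume] (h ⋆[lsmul ℝ ℝ, volume] f) := by
  have hfn : LocallyIntegrable (fun x => ‖f x‖) volume := fun x => (hf x).norm
  have key : ∀ {h k : ℂ → ℝ}, Continuous h → HasCompactSupport h → Continuous k →
      HasCompactSupport k → (h ⋆[lsmul ℝ ℝ, volume] k) ⋆[lsmul ℝ ℝ, volume] f =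
        h ⋆[lsmul ℝ ℝ, volume] (k ⋆[lsmul ℝ ℝ, volume] f) := by
    intro h k hh hhs hk hks
    ext x
    refine convolution_assoc _ _ _ _ (fun a b c => by simp [mul_assoc])
      hh.aestronglyMeasurable hk.aestronglyMeasurable hf.aestronglyMeasurable
      (ae_of_all _ fun y => hhs.convolutionExists_left _ hh (hk.locallyIntegrable) y)
      (ae_of_all _ fun y => hks.norm.convolutionExists_left _ hk.norm hfn y) ?_
    exact hhs.norm.convolutionExists_left _ hh.norm
      (hks.norm.continuous_convolution_left _ hk.norm hfn).locallyIntegrable x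
  rw [← key hh hhs hk hks, ← key hk hks hh hhs]
  congr 1
  rw [← convolution_flip]
  congr 1
  ext; simp

/-- A smooth rotation invariant bump supported in the unit disc. -/
def radialBump (z : ℂ) : ℝ := Real.smoothTransition (1 - ‖z‖ ^ 2)

lemma isTest_radialBump : IsTest radialBump := by
  refine ⟨Real.smoothTransition.contDiff.comp (contDiff_const.sub (contDiff_norm_sq ℝ)),
    HasCompactSupport.intro (isCompact_closedBall (0 : ℂ) 1) fun z hz => ?_⟩
  refine Real.smoothTransition.zero_of_nonpos ?_
  have : 1 < ‖z‖ := by simpa using hz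
  nlinarith

lemma integral_radialBump_pos : 0 < ∫ z, radialBump z := by
  refine isTest_radialBump.1.continuous.integral_pos_of_hasCompactSupport_nonneg_nonzero
    isTest_radialBump.2 (fun z => Real.smoothTransition.nonneg _) (x := 0) ?_
  simp [radialBump]

/-- **Weyl's lemma**: a locally integrable weakly holomorphic function is a.e. equal to an entire
function. -/
theorem WeaklyHolomorphic.exists_ae_eq {f : ℂ → ℂ} (hw : WeaklyHolomorphic f)
    (hf : LocallyIntegrable f volume) : ∃ F : ℂ → ℂ, Differentiable ℂ F ∧ f =ᵐ[volume] F := by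
  set c := ∫ z, radialBump z with hc
  have hc0 : c ≠ 0 := integral_radialBump_pos.ne'
  have hb := isTest_radialBump
  set G := radialBump ⋆[lsmul ℝ ℝ, volume] f with hG
  have hGd : Differentiable ℂ G := hw.differentiable_convolution hf hb
  refine ⟨c⁻¹ • G, hGd.const_smul _, ?_⟩
  -- The ratio of outer to inner radius stays equal to 2, as almost everywhere convergence of the
  -- mollifications requires (`K := 2` below).
  let φ : ℕ → ContDiffBump (0 : ℂ) := fun n =>
    ⟨1 / ((n : ℝ) + 1), 2 * (1 / ((n : ℝ) + 1)), by positivity, by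
      have : 0 < 1 / ((n : ℝ) + 1) := by positivity
      linarith⟩
  have hφ : Tendsto (fun n => (φ n).rOut) atTop (𝓝 0) := by
    simpa [φ] using (tendsto_one_div_add_atTop_nhds_zero_nat (𝕜 := ℝ)).const_mul 2
  filter_upwards [ContDiffBump.ae_convolution_tendsto_right_of_locallyIntegrable (μ := volume)
    hφ (K := 2) (Eventually.of_forall fun n => le_rfl) hf] with x hx
  have hx' := ContDiffBump.convolution_tendsto_right_of_continuous (μ := volume) hφ
    hGd.continuous x
  -- Each `φ n ⋆ f` is entire, so the radial bump only multiplies it by `c`; letting `n → ∞` gives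
  -- `c f = G` almost everywhere.
  have heq : ∀ n, c • ((φ n).normed volume ⋆[lsmul ℝ ℝ, volume] f) x =
      ((φ n).normed volume ⋆[lsmul ℝ ℝ, volume] G) x := by
    intro n
    have ht : IsTest ((φ n).normed volume) :=
      ⟨(φ n).contDiff_normed, (φ n).hasCompactSupport_normed⟩
    rw [hG, convolution_left_comm ht.1.continuous ht.2 hb.1.continuous hb.2 hf]
    refine (integral_radial_smul (hw.differentiable_convolution hf ht) hb.1.continuous hb.2
      (fun u z => ?_) x).symm
    simp [radialBump, Circle.norm_coe]
  have := tendsto_nhds_unique (hx.const_smul c) (by simpa only [heq] using hx')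
  simp [← this, hc0]

/-! ### Logarithmic spiral coordinates -/

/-- The linear chart `(t, s) ↦ s + (a + i) t`; its exponential is `e^s Z(t)`. -/
def spiralLog (a : ℝ) : ℝ × ℝ ≃ₜ ℂ where
  toFun p := ⟨p.2 + a * p.1, p.1⟩
  invFun z := (z.im, z.re - a * z.im)
  left_inv p := by simp
  right_inv z := by simp
  continuous_toFun := by
    have : (fun p : ℝ × ℝ => (⟨p.2 + a * p.1, p.1⟩ : ℂ)) =
        fun p : ℝ × ℝ => ((p.2 + a * p.1 : ℝ) : ℂ) + (p.1 : ℝ) * I := by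
      funext p; apply Complex.ext <;> simp
    rw [this]
    fun_prop
  continuous_invFun := by fun_prop

lemma spiralLog_apply (a t s : ℝ) : spiralLog a (t, s) = s + (a + I) * t := by
  apply Complex.ext <;> simp [spiralLog]

lemma exp_spiralLog (a t s : ℝ) : exp (spiralLog a (t, s)) = exp s * Z a t := by
  rw [spiralLog_apply, Complex.exp_add, Z]

lemma norm_Z (a θ : ℝ) : ‖Z a θ‖ = Real.exp (a * θ) := by
  simp [Z, norm_exp]

lemma tendsto_Z_atBot {a : ℝ} (ha : 0 < a) : Tendsto (Z a) atBot (𝓝 0) := by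
  rw [tendsto_zero_iff_norm_tendsto_zero]
  simp only [norm_Z]
  exact Real.tendsto_exp_atBot.comp (tendsto_id.const_mul_atBot ha)

lemma tendsto_expMulZ (a θ : ℝ) :
    Tendsto (fun p : ℝ × ℝ => exp p.1 * Z a p.2) (𝓝 ((0 : ℝ), θ)) (𝓝 (Z a θ)) := by
  have : Continuous fun p : ℝ × ℝ => exp p.1 * Z a p.2 := by unfold Z; fun_prop
  simpa using this.tendsto ((0 : ℝ), θ)

lemma leftOf_le_nhds (a θ : ℝ) : leftOf a θ ≤ 𝓝 (Z a θ) := by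
  refine (tendsto_expMulZ a θ).mono_left ?_
  rw [nhds_prod_eq]
  exact Filter.prod_mono_left _ nhdsWithin_le_nhds

/-- Sets of full measure meet every one-sided neighbourhood of a point of the spiral. -/
instance neBot_leftOf_inf_ae (a θ : ℝ) : (leftOf a θ ⊓ ae (volume : Measure ℂ)).NeBot := by
  rw [Filter.inf_neBot_iff]
  intro s hs s' hs'
  obtain ⟨u, hu, v, hv, huv⟩ := Filter.mem_prod_iff.1 (Filter.mem_map.1 hs)
  obtain ⟨l, hl, hlu⟩ := mem_nhdsLT_iff_exists_Ioo_subset.1 hu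
  obtain ⟨v', hv', hv'o, hv'm⟩ := mem_nhds_iff.1 hv
  -- The chart and `exp` are open maps, so a one-sided neighbourhood contains a nonempty open set,
  -- which a null set cannot cover.
  have hopen : IsOpen (exp '' (spiralLog a '' (v' ×ˢ Set.Ioo l 0))) :=
    isOpenMap_exp _ ((spiralLog a).isOpenMap _ (hv'o.prod isOpen_Ioo))
  have hl0 : l < 0 := hl
  have hne : (exp '' (spiralLog a '' (v' ×ˢ Set.Ioo l 0))).Nonempty :=
    ((Set.Nonempty.prod ⟨θ, hv'm⟩ (Set.nonempty_Ioo.2 hl0)).image _).image _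
  have hpos := hopen.measure_pos volume hne
  obtain ⟨z, hz, hzs⟩ : ((exp '' (spiralLog a '' (v' ×ˢ Set.Ioo l 0))) ∩ s').Nonempty := by
    by_contra hcon
    rw [Set.not_nonempty_iff_eq_empty] at hcon
    refine hpos.ne' (measure_mono_null (t := s'ᶜ) (fun z hz hz' => ?_) (mem_ae_iff.1 hs'))
    have : z ∈ (∅ : Set ℂ) := hcon ▸ ⟨hz, hz'⟩
    exact this
  obtain ⟨_, ⟨⟨t, x⟩, ⟨ht, hx⟩, rfl⟩, rfl⟩ := hz
  refine ⟨_, ?_, hzs⟩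
  rw [exp_spiralLog]
  exact huv (show ((x, t) : ℝ × ℝ) ∈ u ×ˢ v from ⟨hlu hx, hv' ht⟩)

/-! ### Uniqueness -/

lemma inner_normal (a θ : ℝ) (w : ℂ) :
    inner ℝ (normal a θ) w =
      (I * (a - I) * exp (-(θ * I)) * w).re / Real.sqrt (a ^ 2 + 1) := by
  rw [Complex.inner, ← div_ofReal_re]
  congr 1
  simp only [normal, tangent, map_mul, map_neg, map_div₀, map_add, conj_I, conj_ofReal, ← exp_conj]
  ring_nf

/-- An entire function whose conjugate is tangent to the spiral vanishes. -/
lemma eq_zero_of_inner_normal_eq_zero {a : ℝ} (ha : 0 < a) {F : ℂ → ℂ} (hF : Differentiable ℂ F)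
    (h : ∀ θ, inner ℝ (normal a θ) (conj (F (Z a θ))) = 0) : F = 0 := by
  have hsq : Real.sqrt (a ^ 2 + 1) ≠ 0 := by positivity
  have h' : ∀ θ : ℝ, (-I * (a + I) * exp (θ * I) * F (Z a θ)).re = 0 := by
    intro θ
    have := h θ
    rw [inner_normal, div_eq_zero_iff, or_iff_left hsq, ← conj_re] at this
    simpa [← exp_conj] using this
  by_contra hne
  have han : AnalyticOnNhd ℂ F Set.univ := fun z _ => hF.analyticAt z
  have hnz : ¬ ∀ᶠ z in 𝓝 (0 : ℂ), F z = 0 := fun hz =>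
    hne (funext fun z => han.eqOn_zero_of_preconnected_of_eventuallyEq_zero
      isPreconnected_univ (Set.mem_univ 0) hz (Set.mem_univ z))
  obtain ⟨m, G, hG, hG0, hFG⟩ :=
    (hF.analyticAt 0).exists_eventuallyEq_pow_smul_nonzero_iff.2 hnz
  have hC : ∀ φ : ℝ, (-I * (a + I) * exp (φ * I) * G 0).re = 0 := by
    intro φ
    -- Chosen so that `(m + 1) θ n ≡ φ` mod `2π` and `θ n → -∞`. The `+ 1` comes from the factor
    -- `e^{iθ}` of the normal.
    let θ : ℕ → ℝ := fun n => (φ + n * (-(2 * Real.pi))) / (m + 1)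
    have hθ : Tendsto θ atTop atBot := by
      refine Tendsto.atBot_div_const (by positivity) (tendsto_atBot_add_const_left _ _ ?_)
      exact tendsto_natCast_atTop_atTop.atTop_mul_const_of_neg (by simp [Real.pi_pos])
    have hZ := (tendsto_Z_atBot ha).comp hθ
    have hlim : Tendsto (fun n => (-I * (a + I) * exp (φ * I) * G (Z a (θ n))).re) atTop
        (𝓝 (-I * (a + I) * exp (φ * I) * G 0).re) :=
      (continuous_re.tendsto _).comp ((hG.continuousAt.tendsto.comp hZ).const_mul _)
    refine tendsto_nhds_unique hlim (tendsto_const_nhds.congr' ?_)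
    filter_upwards [hZ.eventually hFG] with n hn
    have h1 := h' (θ n)
    simp only [Function.comp_apply, sub_zero, smul_eq_mul] at hn
    have hZm : exp (θ n * I) * Z a (θ n) ^ m = Real.exp (m * (a * θ n)) * exp (φ * I) := by
      rw [Z, ← Complex.exp_nat_mul, ofReal_exp, ← Complex.exp_add, ← Complex.exp_add,
        Complex.exp_eq_exp_iff_exists_int]
      refine ⟨-n, ?_⟩
      have hm : (m : ℂ) + 1 ≠ 0 := by exact_mod_cast m.succ_ne_zero
      simp only [θ]
      push_cast
      field_simp
      ring
    rw [hn, show -I * (a + I) * exp (θ n * I) * (Z a (θ n) ^ m * G (Z a (θ n))) =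
      (exp (θ n * I) * Z a (θ n) ^ m) * (-I * (a + I) * G (Z a (θ n))) by ring, hZm, mul_assoc,
      re_ofReal_mul, mul_eq_zero, or_iff_right (Real.exp_ne_zero _)] at h1
    rw [← h1]
    ring_nf
  -- The phases `0` and `π/2` kill the real and the imaginary part of `-i(a+i) G(0)`.
  have e1 := hC 0
  have e2 := hC (Real.pi / 2)
  simp only [ofReal_zero, zero_mul, Complex.exp_zero, mul_one] at e1
  rw [show ((Real.pi / 2 : ℝ) : ℂ) = (Real.pi : ℂ) / 2 by push_cast; rfl, exp_pi_div_two_mul_I,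
    mul_right_comm, mul_I_re, neg_eq_zero] at e2
  have : -I * (a + I) * G 0 = 0 := Complex.ext e1 e2
  have haI : (a : ℂ) + I ≠ 0 := fun h => by simpa using congrArg im h
  simp [hG0, haI] at this

lemma locallyIntegrable_conj {w : ℂ → ℂ} (hw : LocallyIntegrable w volume) :
    LocallyIntegrable (fun z => conj (w z)) volume := by
  intro z
  obtain ⟨s, hs, hi⟩ := hw z
  exact ⟨s, hs, (conjCLE : ℂ →L[ℝ] ℂ).integrable_comp hi⟩

lemma integrable_conj_mul_dbar {w : ℂ → ℂ} (hw : LocallyIntegrable w volume) {φ : ℂ → ℝ}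
    (hφ : IsTest φ) : Integrable fun z => conj (w z) * (fderiv ℝ φ z 1 + I * fderiv ℝ φ z I) := by
  refine ((integrable_mul_fderiv (locallyIntegrable_conj hw) hφ 1).add
    ((integrable_mul_fderiv (locallyIntegrable_conj hw) hφ I).const_mul I)).congr
    (ae_of_all _ fun z => ?_)
  simp only [Pi.add_apply]
  ring

/-- The curl and divergence conditions, combined into one complex identity. -/
lemma integral_conj_mul_dbar {a g : ℝ} {w : ℂ → ℂ} (hw : LocallyIntegrable w volume)
    (hdiv : WeaklyDivFree w) (hcurl : WeakCurlEqSheet a g w) {φ : ℂ → ℝ} (hφ : IsTest φ) :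
    ∫ z, conj (w z) * (fderiv ℝ φ z 1 + I * fderiv ℝ φ z I) = I * sheetPairing a g φ := by
  have hint := integrable_conj_mul_dbar hw hφ
  apply Complex.ext
  · have := reCLM.integral_comp_comm hint
    simp only [reCLM_apply] at this
    rw [← this, show (I * (sheetPairing a g φ : ℂ)).re = 0 by simp, ← hdiv φ hφ]
    congr 1; ext z; simp
  · have := imCLM.integral_comp_comm hint
    simp only [imCLM_apply] at this
    rw [← this, show (I * (sheetPairing a g φ : ℂ)).im = sheetPairing a g φ by simp, ← hcurl φ hφ]
    congr 1; ext z; simp; ring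

/-- Two fields with the same divergence and curl and the same normal component on the inner side
of the spiral coincide. -/
lemma ae_eq_of_matching {a g μ : ℝ} (ha : 0 < a) {w₁ w₂ : ℂ → ℂ}
    (hi₁ : LocallyIntegrable w₁ volume) (hi₂ : LocallyIntegrable w₂ volume)
    (hd : ∀ φ, IsTest φ → ∫ z, conj (w₁ z) * (fderiv ℝ φ z 1 + I * fderiv ℝ φ z I) =
      I * sheetPairing a g φ)
    (hd' : ∀ φ, IsTest φ → ∫ z, conj (w₂ z) * (fderiv ℝ φ z 1 + I * fderiv ℝ φ z I) =
      I * sheetPairing a g φ)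
    (hm : VelocityMatching a μ w₁)
    (hm' : VelocityMatching a μ w₂) : w₁ =ᵐ[volume] w₂ := by
  have hweak : WeaklyHolomorphic fun z => conj (w₁ z) - conj (w₂ z) := by
    intro φ hφ
    simp_rw [sub_mul]
    rw [integral_sub (integrable_conj_mul_dbar hi₁ hφ) (integrable_conj_mul_dbar hi₂ hφ),
      hd φ hφ, hd' φ hφ, sub_self]
  obtain ⟨F, hF, hae⟩ := hweak.exists_ae_eq ((locallyIntegrable_conj hi₁).sub (locallyIntegrable_conj hi₂))
  have hF0 : F = 0 := by
    refine eq_zero_of_inner_normal_eq_zero ha hF fun θ => ?_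
    have hcont : Tendsto (fun z => inner ℝ (normal a θ) (conj (F z)))
        (leftOf a θ ⊓ ae volume) (𝓝 (inner ℝ (normal a θ) (conj (F (Z a θ))))) := by
      have : Continuous fun z => inner ℝ (normal a θ) (conj (F z)) :=
        continuous_const.inner (continuous_conj.comp hF.continuous)
      exact (this.tendsto _).mono_left (inf_le_left.trans (leftOf_le_nhds a θ))
    have hdiff := ((hm θ).1).sub (hm' θ).1
    rw [sub_self] at hdiff
    refine tendsto_nhds_unique hcont (hdiff.congr' ?_)
    filter_upwards [hae.filter_mono inf_le_right] with z hz
    rw [← hz, ← inner_sub_right]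
    simp
  filter_upwards [hae] with z hz
  rw [hF0, Pi.zero_apply, sub_eq_zero] at hz
  exact star_injective hz

/-! ### The profile in spiral coordinates -/

lemma ofReal_add_I_ne_zero (a : ℝ) : (a : ℂ) + I ≠ 0 := fun h => by simpa using congrArg im h

/-- The growth exponent `2a / (a + i)` of the profile. -/
def growthExp (a : ℝ) : ℂ := 2 * a / (a + I)

/-- Along the spiral `ζ` moves in the direction `a + i`, so `e^{αζ}` grows there like the real
exponential `e^{2at}`, as the circulation does. -/
lemma growthExp_mul (a : ℝ) : growthExp a * (a + I) = 2 * a :=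
  div_mul_cancel₀ _ (ofReal_add_I_ne_zero a)

lemma expA_eq (a : ℝ) : expA a = -I * growthExp a := by
  rw [expA, growthExp]; ring

lemma expA_re (a : ℝ) : (expA a).re = -(2 * a) / (1 + a ^ 2) := by
  have h : (1 : ℝ) + a ^ 2 ≠ 0 := by positivity
  simp [expA, div_re, normSq_apply]
  field_simp
  ring

lemma expA_im (a : ℝ) : (expA a).im = -(2 * a ^ 2) / (1 + a ^ 2) := by
  have h : (1 : ℝ) + a ^ 2 ≠ 0 := by positivity
  simp [expA, div_im, normSq_apply]
  field_simp
  ring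

/-- The monodromy factor `e^{2πA}`. -/
def monodromy (a : ℝ) : ℂ := exp (2 * Real.pi * expA a)

lemma monodromy_eq (a : ℝ) : monodromy a =
    Real.exp (-(4 * Real.pi * a / (1 + a ^ 2))) *
      exp (-(4 * Real.pi * a ^ 2 / (1 + a ^ 2) : ℝ) * I) := by
  rw [monodromy, ofReal_exp, ← Complex.exp_add]
  congr 1
  apply Complex.ext
  · simp only [mul_re, add_re, expA_re, mul_im, ofReal_re, ofReal_im, neg_re, neg_im, I_re, I_im,
      re_ofNat, im_ofNat]
    ring
  · simp only [add_im, expA_im, mul_im, mul_re, ofReal_re, ofReal_im, neg_re, neg_im, I_re, I_im,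
      re_ofNat, im_ofNat]
    ring

lemma norm_monodromy_lt_one {a : ℝ} (ha : 0 < a) : ‖monodromy a‖ < 1 := by
  rw [monodromy_eq, norm_mul, ← ofReal_neg, norm_exp_ofReal_mul_I, mul_one, norm_real,
    Real.norm_of_nonneg (Real.exp_nonneg _), Real.exp_lt_one_iff, neg_lt_zero]
  positivity

lemma one_sub_monodromy_ne_zero {a : ℝ} (ha : 0 < a) : 1 - monodromy a ≠ 0 := fun h => by
  have := norm_monodromy_lt_one ha
  rw [← sub_eq_zero.1 h] at this
  simp at this

lemma windingJ_eq {a : ℝ} (ha : 0 < a) (r θ : ℝ) :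
    windingJ a r θ = ⌊(a * θ - Real.log r) / (2 * Real.pi * a)⌋ + 1 := by
  rw [windingJ, ← csInf_Ici (a := ⌊(a * θ - Real.log r) / (2 * Real.pi * a)⌋ + 1)]
  congr 1
  ext j
  rw [Set.mem_ofPred_eq, Set.mem_Ici, Int.add_one_le_iff, Int.floor_lt,
    div_lt_iff₀ (by positivity)]
  constructor <;> intro h <;> linarith

/-- The winding number of the point `e^s Z(t)`, normalised to the branch `t` of its argument. -/
def sheetIndex (a s : ℝ) : ℤ := ⌊-s / (2 * Real.pi * a)⌋ + 1

lemma sheetIndex_of_mem_Ioc {a s : ℝ} (ha : 0 < a) (hs : s ∈ Set.Ioc 0 (2 * Real.pi * a)) :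
    sheetIndex a s = 0 := by
  have hp : 0 < 2 * Real.pi * a := by positivity
  have : ⌊-s / (2 * Real.pi * a)⌋ = -1 := by
    rw [Int.floor_eq_iff, le_div_iff₀ hp]
    push_cast
    refine ⟨by linarith [hs.2], ?_⟩
    rw [neg_add_cancel, div_neg_iff]
    exact Or.inr ⟨neg_lt_zero.2 hs.1, hp⟩
  rw [sheetIndex, this]; rfl

lemma sheetIndex_of_mem_Ioo {a s : ℝ} (ha : 0 < a) (hs : s ∈ Set.Ioo (-(2 * Real.pi * a)) 0) :
    sheetIndex a s = 1 := by
  have hp : 0 < 2 * Real.pi * a := by positivity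
  have : ⌊-s / (2 * Real.pi * a)⌋ = 0 := by
    rw [Int.floor_eq_zero_iff, Set.mem_Ico, div_lt_one hp]
    exact ⟨div_nonneg (by linarith [hs.2]) hp.le, by linarith [hs.1]⟩
  rw [sheetIndex, this]; rfl

lemma windingJ_exp {a : ℝ} (ha : 0 < a) (t s : ℝ) (n : ℤ) :
    windingJ a (Real.exp (s + a * t)) (t + n * (2 * Real.pi)) = sheetIndex a s + n := by
  rw [windingJ_eq ha, Real.log_exp, sheetIndex]
  have : (a * (t + n * (2 * Real.pi)) - (s + a * t)) / (2 * Real.pi * a) =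
      -s / (2 * Real.pi * a) + n := by
    field_simp
    ring
  rw [this, Int.floor_add_intCast]
  ring

/-- Replacing `θ` by `θ + 2πn` multiplies `e^{-Aθ}` by `e^{-2πnA}` and raises `J` by `n`. The two
changes cancel, so the formula does not depend on the branch of the argument. -/
lemma prandtlProfile_exp {a : ℝ} (ha : 0 < a) (g t s : ℝ) (n : ℤ) :
    prandtlProfile a g (Real.exp (s + a * t)) (t + n * (2 * Real.pi)) =
      conj (2 * a * g / (a + I) * exp ((growthExp a - 1) * spiralLog a (t, s)) *
        (monodromy a ^ sheetIndex a s / (1 - monodromy a))) := by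
  have h1 : exp (2 * Real.pi * (sheetIndex a s + n : ℤ) * expA a) =
      monodromy a ^ sheetIndex a s * exp (2 * Real.pi * n * expA a) := by
    rw [monodromy, ← Complex.exp_int_mul, ← Complex.exp_add]
    push_cast
    ring_nf
  have h2 : exp ((t + n * (2 * Real.pi) : ℝ) * I) = exp (t * I) := by
    rw [Complex.exp_eq_exp_iff_exists_int]
    exact ⟨n, by push_cast; ring⟩
  have h3 : ((Real.exp (s + a * t) : ℝ) : ℂ) ^ (2 * a / (a + I) : ℂ) =
      exp ((s + a * t) * growthExp a) := by
    rw [cpow_def_of_ne_zero (by exact_mod_cast Real.exp_ne_zero _), ← ofReal_log (Real.exp_nonneg _),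
      Real.log_exp, growthExp]
    push_cast
    rfl
  have h4 : exp ((growthExp a - 1) * spiralLog a (t, s)) * exp (-(2 * Real.pi * n * expA a)) =
      exp (-(t * I)) * exp (-(s + a * t)) * (exp ((s + a * t) * growthExp a) *
        exp (-expA a * (t + n * (2 * Real.pi) : ℝ))) := by
    simp only [← Complex.exp_add]
    congr 1
    rw [spiralLog_apply, expA_eq]
    push_cast
    ring
  have h5 : exp ((growthExp a - 1) * spiralLog a (t, s)) =
      exp (-(t * I)) * exp (-(s + a * t)) * (exp ((s + a * t) * growthExp a) *
        exp (-expA a * (t + n * (2 * Real.pi) : ℝ))) * exp (2 * Real.pi * n * expA a) := by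
    rw [← h4, mul_assoc, ← Complex.exp_add]
    simp
  rw [prandtlProfile, windingJ_exp ha, h1, h2, h3, h5, ← monodromy]
  have h6 : exp (t * I) = conj (exp (-(t * I))) := by simp [← exp_conj]
  have h7 : 2 * a * g / ((Real.exp (s + a * t) : ℝ) * (a - I)) =
      conj (2 * a * g / (a + I) * exp (-(s + a * t))) := by
    simp only [map_div₀, map_mul, map_add, conj_ofReal, conj_I, ← exp_conj, map_neg, map_ofNat]
    rw [Complex.exp_neg, ofReal_exp]
    push_cast
    rw [← sub_eq_add_neg]
    simp only [div_eq_mul_inv, mul_inv]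
    ring
  rw [h6, h7, ← map_mul, ← map_mul]
  congr 1
  ring

/-- The profile as a function on the plane. -/
def profileField (a g : ℝ) (z : ℂ) : ℂ := prandtlProfile a g ‖z‖ z.arg

lemma norm_exp_spiralLog (a t s : ℝ) : ‖exp (spiralLog a (t, s))‖ = Real.exp (s + a * t) := by
  rw [norm_exp]
  simp [spiralLog]

lemma exists_eq_add_of_exp_mul_I {r θ θ' : ℝ} (hr : 0 < r)
    (h : r * exp (θ * I) = r * exp (θ' * I)) : ∃ n : ℤ, θ = θ' + n * (2 * Real.pi) := by
  have hr' : (r : ℂ) ≠ 0 := by exact_mod_cast hr.ne'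
  obtain ⟨n, hn⟩ := Complex.exp_eq_exp_iff_exists_int.1 (mul_left_cancel₀ hr' h)
  exact ⟨n, by simpa using congrArg im hn⟩

lemma profileField_eq {a : ℝ} (ha : 0 < a) (g : ℝ) {r θ : ℝ} (hr : 0 < r) :
    profileField a g (r * exp (θ * I)) = prandtlProfile a g r θ := by
  have hn : ‖(r : ℂ) * exp (θ * I)‖ = r := by
    rw [norm_mul, norm_exp_ofReal_mul_I, mul_one, norm_real, Real.norm_of_nonneg hr.le]
  have hz := norm_mul_exp_arg_mul_I ((r : ℂ) * exp (θ * I))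
  rw [hn] at hz
  obtain ⟨n, hn'⟩ := exists_eq_add_of_exp_mul_I hr hz
  rw [profileField, hn, hn']
  have hr' : r = Real.exp ((Real.log r - a * θ) + a * θ) := by
    rw [sub_add_cancel, Real.exp_log hr]
  have h0 := prandtlProfile_exp ha g θ (Real.log r - a * θ) 0
  rw [Int.cast_zero, zero_mul, add_zero] at h0
  rw [hr', prandtlProfile_exp ha, h0]

lemma profileField_exp {a : ℝ} (ha : 0 < a) (g t s : ℝ) :
    profileField a g (exp (spiralLog a (t, s))) =
      conj (2 * a * g / (a + I) * exp ((growthExp a - 1) * spiralLog a (t, s)) *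
        (monodromy a ^ sheetIndex a s / (1 - monodromy a))) := by
  have h : exp (spiralLog a (t, s)) = (Real.exp (s + a * t) : ℝ) * exp (t * I) := by
    rw [spiralLog_apply, ofReal_exp, ← Complex.exp_add]
    push_cast
    ring_nf
  rw [h, profileField_eq ha g (Real.exp_pos _), ← prandtlProfile_exp ha g t s 0, Int.cast_zero,
    zero_mul, add_zero]

/-- The half-open strip `{(t, s) | 0 < s ≤ 2πa}` is mapped by `(t, s) ↦ e^s Z(t)` onto the
punctured plane. -/
lemma exists_exp_spiralLog {a : ℝ} (ha : 0 < a) {z : ℂ} (hz : z ≠ 0) :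
    ∃ t s : ℝ, s ∈ Set.Ioc 0 (2 * Real.pi * a) ∧ exp (spiralLog a (t, s)) = z := by
  -- Lowering the argument `t` by `2πn` raises `s = log ‖z‖ - a t` by `2πan`, so one `n` brings `s`
  -- into the strip.
  obtain ⟨n, hn, -⟩ := existsUnique_add_zsmul_mem_Ioc (by positivity : 0 < 2 * Real.pi * a)
    (Real.log ‖z‖ - a * z.arg) 0
  refine ⟨z.arg - n * (2 * Real.pi), _, by simpa using hn, ?_⟩
  conv_rhs => rw [← Complex.exp_log hz]
  rw [Complex.exp_eq_exp_iff_exists_int, spiralLog_apply]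
  refine ⟨-n, ?_⟩
  apply Complex.ext <;> simp [log_re, log_im]
  all_goals ring

lemma injOn_exp_spiralLog {a : ℝ} (ha : 0 < a) :
    Set.InjOn exp (spiralLog a '' (Set.univ ×ˢ Set.Ioc 0 (2 * Real.pi * a))) := by
  rintro _ ⟨⟨t, s⟩, ⟨-, hs⟩, rfl⟩ _ ⟨⟨t', s'⟩, ⟨-, hs'⟩, rfl⟩ h
  obtain ⟨n, hn⟩ := Complex.exp_eq_exp_iff_exists_int.1 h
  have him : t = t' + n * (2 * Real.pi) := by simpa [spiralLog] using congrArg im hn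
  have hre : s + a * t = s' + a * t' := by simpa [spiralLog] using congrArg re hn
  have hp : 0 < 2 * Real.pi * a := by positivity
  have hss : s' - s = n * (2 * Real.pi * a) := by rw [him] at hre; linarith
  simp only [Set.mem_Ioc] at hs hs'
  have h1 : (n : ℝ) < 1 := by
    by_contra! hc
    nlinarith
  have h2 : (-1 : ℝ) < n := by
    by_contra! hc
    nlinarith
  have hn0 : n = 0 := by
    have h1' : n < 1 := by exact_mod_cast h1
    have h2' : -1 < n := by exact_mod_cast h2
    omega
  rw [hn, hn0]
  simp

/-! ### Measurability, growth and local integrability of the profile. -/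

lemma measurable_profileField {a : ℝ} (ha : 0 < a) (g : ℝ) : Measurable (profileField a g) := by
  unfold profileField prandtlProfile
  simp only [windingJ_eq ha]
  have hfl : Measurable fun z : ℂ =>
      (⌊(a * z.arg - Real.log ‖z‖) / (2 * Real.pi * a)⌋ + 1 : ℤ) :=
    (Int.measurable_floor.comp (by fun_prop)).add_const 1
  have hfl' : Measurable fun z : ℂ =>
      ((⌊(a * z.arg - Real.log ‖z‖) / (2 * Real.pi * a)⌋ + 1 : ℤ) : ℂ) :=
    (measurable_from_top (f := fun n : ℤ => (n : ℂ))).comp hfl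
  have hc : Measurable (starRingEnd ℂ) := continuous_conj.measurable
  refine Measurable.mul (by fun_prop) (hc.comp ?_)
  refine Measurable.mul (by fun_prop) (Measurable.div_const ?_ _)
  exact Complex.measurable_exp.comp ((hfl'.const_mul _).mul_const _)

/-- The amplitude of the holomorphic profile `K e^{(α - 1) ζ}`. -/
def amplitude (a g : ℝ) : ℂ := 2 * a * g / (a + I) / (1 - monodromy a)

lemma profileField_of_mem {a : ℝ} (ha : 0 < a) (g t : ℝ) {s : ℝ}
    (hs : s ∈ Set.Ioc 0 (2 * Real.pi * a)) :
    profileField a g (exp (spiralLog a (t, s))) =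
      conj (amplitude a g * exp ((growthExp a - 1) * spiralLog a (t, s))) := by
  rw [profileField_exp ha, sheetIndex_of_mem_Ioc ha hs, amplitude, zpow_zero]
  congr 1
  ring

lemma norm_exp_growthExp_mul_le {a : ℝ} (t : ℝ) {s : ℝ} (hs : s ∈ Set.Icc 0 (2 * Real.pi * a)) :
    ‖exp (growthExp a * spiralLog a (t, s))‖ ≤
      Real.exp (‖growthExp a‖ * (2 * Real.pi * a)) * Real.exp (2 * a * t) := by
  have : growthExp a * spiralLog a (t, s) = growthExp a * s + (2 * a * t : ℝ) := by
    rw [spiralLog_apply]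
    push_cast
    linear_combination t * growthExp_mul a
  rw [this, Complex.exp_add, norm_mul, ← ofReal_exp, norm_real,
    Real.norm_of_nonneg (Real.exp_nonneg _)]
  gcongr
  refine (norm_exp_le_exp_norm _).trans (Real.exp_le_exp.2 ?_)
  rw [norm_mul, norm_real, Real.norm_of_nonneg hs.1]
  gcongr
  exact hs.2

lemma norm_profileField_le {a : ℝ} (ha : 0 < a) (g : ℝ) {z : ℂ} (hz : z ≠ 0) :
    ‖profileField a g z‖ ≤
      ‖amplitude a g‖ * Real.exp (‖growthExp a‖ * (2 * Real.pi * a)) * ‖z‖ := by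
  obtain ⟨t, s, hs, rfl⟩ := exists_exp_spiralLog ha hz
  rw [profileField_of_mem ha g t hs, RCLike.norm_conj, norm_mul, mul_assoc]
  gcongr
  rw [sub_mul, one_mul, Complex.exp_sub, norm_div, div_le_iff₀ (norm_pos_iff.2 (exp_ne_zero _)),
    norm_exp_spiralLog, mul_assoc, ← Real.exp_add]
  refine (norm_exp_growthExp_mul_le t ⟨hs.1.le, hs.2⟩).trans ?_
  gcongr
  linarith [hs.1]

lemma locallyIntegrable_profileField {a : ℝ} (ha : 0 < a) (g : ℝ) :
    LocallyIntegrable (profileField a g) volume := by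
  set C := ‖amplitude a g‖ * Real.exp (‖growthExp a‖ * (2 * Real.pi * a)) with hC
  have hC0 : 0 ≤ C := by positivity
  have hcont : Continuous fun z : ℂ => C * ‖z‖ := by fun_prop
  refine hcont.locallyIntegrable.mono (measurable_profileField ha g).aestronglyMeasurable ?_
  filter_upwards [compl_mem_ae_iff.2 (measure_singleton (0 : ℂ))] with z hz
  rw [Real.norm_of_nonneg (by positivity)]
  exact norm_profileField_le ha g hz

/-! ### Velocity matching for the profile -/

/-- On the spiral `e^{(α-1)ζ} = e^{aθ} e^{-iθ}`, whose phase cancels that of the normal; only the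
imaginary part of the sheet factor `c` survives. -/
lemma inner_normal_profile (a g θ : ℝ) (c : ℂ) :
    inner ℝ (normal a θ)
      (conj (2 * a * g / (a + I) * exp ((growthExp a - 1) * spiralLog a (θ, 0)) * c)) =
      2 * a * g * Real.exp (a * θ) * c.im / Real.sqrt (a ^ 2 + 1) := by
  rw [inner_normal]
  congr 1
  have hne : (a : ℂ) - I ≠ 0 := fun h => by simpa using congrArg im h
  have h1 : exp ((growthExp a - 1) * spiralLog a (θ, 0)) =
      Real.exp (a * θ) * exp (-(θ * I)) := by
    rw [ofReal_exp, ← Complex.exp_add]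
    congr 1
    rw [spiralLog_apply]
    push_cast
    linear_combination (θ : ℂ) * growthExp_mul a
  have h2 : I * (a - I) * exp (-(θ * I)) *
      conj (2 * a * g / (a + I) * exp ((growthExp a - 1) * spiralLog a (θ, 0)) * c) =
      (2 * a * g * Real.exp (a * θ) : ℝ) * (I * conj c) := by
    rw [h1]
    simp only [map_mul, map_div₀, map_add, conj_ofReal, conj_I, ← exp_conj, map_neg, map_ofNat,
      mul_neg, neg_neg]
    rw [← sub_eq_add_neg]
    have h3 : exp (-(θ * I)) * exp (θ * I) = 1 := by rw [← Complex.exp_add]; simp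
    have h4 : ((a : ℂ) - I) * (a - I)⁻¹ = 1 := mul_inv_cancel₀ hne
    rw [div_eq_mul_inv]
    push_cast
    linear_combination (2 * a * g * exp (a * θ) * I * conj c) *
      (exp (-(θ * I)) * exp (θ * I) * h4 + h3)
  rw [h2, re_ofReal_mul]
  simp

lemma inner_normal_mul_Z (a μ θ : ℝ) :
    inner ℝ (normal a θ) ((μ : ℂ) * Z a θ) = μ * Real.exp (a * θ) / Real.sqrt (a ^ 2 + 1) := by
  rw [inner_normal]
  congr 1
  have h : I * (a - I) * exp (-(θ * I)) * (μ * Z a θ) =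
      (μ * Real.exp (a * θ) : ℝ) * (I * a + 1) := by
    have hZ : Z a θ = exp (a * θ) * exp (θ * I) := by
      rw [Z, ← Complex.exp_add]; ring_nf
    have h3 : exp (-(θ * I)) * exp (θ * I) = 1 := by rw [← Complex.exp_add]; simp
    rw [hZ]
    push_cast
    linear_combination (I * (a - I) * μ * exp (a * θ)) * h3 - μ * exp (a * θ) * I_sq
  rw [h, re_ofReal_mul]
  simp

/-- The pressure relation fixes the imaginary part of the amplitude factor `1 / (1 - e^{2πA})`. -/
lemma PressureMatching.im_inv {a g μ : ℝ} (ha : 0 < a) (h : PressureMatching a g μ) :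
    2 * a * g * (1 - monodromy a)⁻¹.im = μ := by
  set ρ := Real.exp (-(4 * Real.pi * a / (1 + a ^ 2))) with hρ
  set β := 4 * Real.pi * a ^ 2 / (1 + a ^ 2) with hβ
  have hρ0 : 0 < ρ := Real.exp_pos _
  have hinv : Real.exp (4 * Real.pi * a / (1 + a ^ 2)) = ρ⁻¹ := by
    rw [hρ, Real.exp_neg, inv_inv]
  have hneg : Real.exp (-4 * Real.pi * a / (1 + a ^ 2)) = ρ := by
    rw [hρ]; congr 1; ring
  have hm : monodromy a = ρ * exp (-(β : ℝ) * I) := monodromy_eq a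
  have hre : (monodromy a).re = ρ * Real.cos β := by
    rw [hm, re_ofReal_mul, ← ofReal_neg, exp_ofReal_mul_I_re, Real.cos_neg]
  have him : (monodromy a).im = -(ρ * Real.sin β) := by
    rw [hm, im_ofReal_mul, ← ofReal_neg, exp_ofReal_mul_I_im, Real.sin_neg, mul_neg]
  have hpos : 0 < normSq (1 - monodromy a) := normSq_pos.2 (one_sub_monodromy_ne_zero ha)
  have hsq : normSq (1 - monodromy a) = 1 - 2 * ρ * Real.cos β + ρ ^ 2 := by
    rw [normSq_apply, sub_re, sub_im, hre, him, one_re, one_im]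
    linear_combination ρ ^ 2 * Real.sin_sq_add_cos_sq β
  rw [PressureMatching, hinv, hneg, ← hβ] at h
  rw [inv_im, sub_im, him, one_im, mul_div_assoc', div_eq_iff hpos.ne', hsq]
  have hρρ : ρ * ρ⁻¹ = 1 := mul_inv_cancel₀ hρ0.ne'
  linear_combination (-ρ) * h + μ * hρρ

lemma velocityMatching_profileField {a g μ : ℝ} (ha : 0 < a) (h : PressureMatching a g μ) :
    VelocityMatching a μ (profileField a g) := by
  have hp : 0 < 2 * Real.pi * a := by positivity
  have key : ∀ (l : Filter ℝ) (j : ℤ) (c : ℂ), l ≤ 𝓝 0 → (∀ᶠ s in l, sheetIndex a s = j) →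
      monodromy a ^ j / (1 - monodromy a) = c → 2 * a * g * c.im = μ → ∀ θ : ℝ,
      Tendsto (fun z => inner ℝ (normal a θ) (profileField a g z))
        (map (fun p : ℝ × ℝ => exp p.1 * Z a p.2) (l ×ˢ 𝓝 θ))
        (𝓝 (inner ℝ (normal a θ) ((μ : ℂ) * Z a θ))) := by
    intro l j c hl hj hc hcμ θ
    rw [tendsto_map'_iff]
    have hcont : Continuous fun p : ℝ × ℝ => inner ℝ (normal a θ)
        (conj (2 * a * g / (a + I) *
          exp ((growthExp a - 1) * spiralLog a (p.2, p.1)) * c)) := by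
      have := (spiralLog a).continuous
      have := continuous_conj
      exact continuous_const.inner (continuous_conj.comp (by fun_prop))
    have hlim := (hcont.tendsto (0, θ)).mono_left
      (show l ×ˢ 𝓝 θ ≤ 𝓝 ((0 : ℝ), θ) by rw [nhds_prod_eq]; exact Filter.prod_mono_left _ hl)
    simp only [inner_normal_profile] at hlim
    rw [inner_normal_mul_Z, ← hcμ]
    have hval : 2 * a * g * Real.exp (a * θ) * c.im / Real.sqrt (a ^ 2 + 1) =
        2 * a * g * c.im * Real.exp (a * θ) / Real.sqrt (a ^ 2 + 1) := by ring
    rw [← hval]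
    refine hlim.congr' ?_
    filter_upwards [hj.prod_inl (𝓝 θ)] with p hp
    rw [Function.comp_apply, ← exp_spiralLog, profileField_exp ha, hp, hc]
  have him := h.im_inv ha
  intro θ
  constructor
  -- The inner factor `e^{2πA}/(1 - e^{2πA})` is the outer one minus `1`, so the imaginary parts
  -- agree and the normal component does not jump.
  · refine (key (𝓝[<] 0) 1 ((1 - monodromy a)⁻¹ - 1) nhdsWithin_le_nhds ?_ ?_
      (by rwa [sub_im, one_im, sub_zero]) θ).mono_left
      inf_le_left
    · filter_upwards [Ioo_mem_nhdsLT (neg_lt_zero.2 hp)] with s hs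
      exact sheetIndex_of_mem_Ioo ha hs
    · have := one_sub_monodromy_ne_zero ha
      rw [zpow_one]
      field_simp
      ring
  · refine (key (𝓝[>] 0) 0 (1 - monodromy a)⁻¹ nhdsWithin_le_nhds ?_ (by simp) him θ).mono_left
      inf_le_left
    filter_upwards [Ioo_mem_nhdsGT hp] with s hs
    exact sheetIndex_of_mem_Ioc ha ⟨hs.1, hs.2.le⟩

/-! ### Change of variables -/

/-- The measure `dt ds` on the strip `{(t, s) | 0 < s ≤ 2πa}`. -/
def stripMeasure (a : ℝ) : Measure (ℝ × ℝ) :=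
  (volume : Measure ℝ).prod (volume.restrict (Set.Ioc 0 (2 * Real.pi * a)))

lemma ae_mem_strip (a : ℝ) :
    ∀ᵐ p ∂stripMeasure a, p ∈ Set.univ ×ˢ Set.Ioc 0 (2 * Real.pi * a) := by
  rw [stripMeasure, ← Measure.restrict_univ (μ := (volume : Measure ℝ)), Measure.prod_restrict]
  exact ae_restrict_mem (MeasurableSet.univ.prod measurableSet_Ioc)

lemma measurePreserving_spiralLog (a : ℝ) : MeasurePreserving (spiralLog a) := by
  have h1 : MeasurePreserving (fun p : ℝ × ℝ => (p.1, p.2 + a * p.1))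
      (volume.prod volume) (volume.prod volume) :=
    (MeasurePreserving.id _).skew_product (g := fun t s => s + a * t) (by fun_prop)
      (ae_of_all _ fun t => map_add_right_eq_self _ _)
  exact (volume_preserving_equiv_real_prod.symm measurableEquivRealProd).comp
    (Measure.measurePreserving_swap.comp h1)

/-- The real determinant of a complex linear map is the field norm from `ℂ` to `ℝ` of its complex
determinant. -/
lemma abs_det_exp (ζ : ℂ) :
    |((ContinuousLinearMap.toSpanSingleton ℂ (exp ζ)).restrictScalars ℝ).det| =
      normSq (exp ζ) := by
  have : ((ContinuousLinearMap.toSpanSingleton ℂ (exp ζ)).restrictScalars ℝ).det =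
      normSq (exp ζ) := by
    rw [ContinuousLinearMap.det]
    change LinearMap.det
      ((ContinuousLinearMap.toSpanSingleton ℂ (exp ζ)).toLinearMap.restrictScalars ℝ) = _
    rw [LinearMap.det_restrictScalars]
    simp [Algebra.norm_complex_eq]
  rw [this, abs_of_nonneg (normSq_nonneg _)]

/-- Integration over the plane in the coordinates `z = e^s Z(t)`. -/
lemma integral_eq_integral_strip {a : ℝ} (ha : 0 < a) (f : ℂ → ℂ) :
    ∫ z, f z = ∫ p, normSq (exp (spiralLog a p)) • f (exp (spiralLog a p)) ∂stripMeasure a := by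
  set S : Set (ℝ × ℝ) := Set.univ ×ˢ Set.Ioc 0 (2 * Real.pi * a) with hS
  have hSm : MeasurableSet S := MeasurableSet.univ.prod measurableSet_Ioc
  have hemb : MeasurableEmbedding (spiralLog a) := (spiralLog a).measurableEmbedding
  have himg : exp '' (spiralLog a '' S) = {0}ᶜ := by
    ext z
    constructor
    · rintro ⟨ζ, -, rfl⟩
      exact exp_ne_zero ζ
    · intro hz
      obtain ⟨t, s, hs, h⟩ := exists_exp_spiralLog ha hz
      exact ⟨_, ⟨(t, s), ⟨Set.mem_univ _, hs⟩, rfl⟩, h⟩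
  have hfull : ∫ z, f z = ∫ z in exp '' (spiralLog a '' S), f z := by
    rw [himg, restrict_compl_singleton]
  rw [hfull, integral_image_eq_integral_abs_det_fderiv_smul volume (hemb.measurableSet_image.2 hSm)
    (fun ζ _ => ((hasDerivAt_exp ζ).hasFDerivAt.restrictScalars ℝ).hasFDerivWithinAt)
    (injOn_exp_spiralLog ha), (measurePreserving_spiralLog a).setIntegral_image_emb hemb]
  simp only [abs_det_exp]
  rw [stripMeasure, ← Measure.restrict_univ (μ := (volume : Measure ℝ)), Measure.prod_restrict]
  rw [Measure.restrict_univ]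
  rfl

/-! ### The divergence and the curl of the profile -/

/-- The integrable majorant `e^{2at}` on `t ≤ T`, extended by zero. -/
def cutoffExp (a T : ℝ) : ℝ → ℝ := (Set.Iic T).indicator fun t => Real.exp (2 * a * t)

lemma integrable_cutoffExp {a : ℝ} (ha : 0 < a) (T : ℝ) : Integrable (cutoffExp a T) :=
  (integrableOn_exp_mul_Iic (by positivity : 0 < 2 * a) T).integrable_indicator measurableSet_Iic

lemma tendsto_cutoffExp_atBot {a : ℝ} (ha : 0 < a) (T : ℝ) :
    Tendsto (cutoffExp a T) atBot (𝓝 0) := by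
  refine (Real.tendsto_exp_atBot.comp
    (tendsto_id.const_mul_atBot (by positivity : 0 < 2 * a))).congr' ?_
  filter_upwards [Iic_mem_atBot T] with t ht
  rw [cutoffExp, Set.indicator_of_mem ht]
  rfl

lemma tendsto_cutoffExp_atTop (a T : ℝ) : Tendsto (cutoffExp a T) atTop (𝓝 0) := by
  refine tendsto_const_nhds.congr' ?_
  filter_upwards [Ioi_mem_atTop T] with t ht
  rw [cutoffExp, Set.indicator_of_notMem (by simpa using ht)]

lemma integrable_slice {a C T : ℝ} (ha : 0 < a) {E : ℝ → ℂ} (hE : Continuous E)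
    (hb : ∀ t, ‖E t‖ ≤ C * cutoffExp a T t) : Integrable E :=
  ((integrable_cutoffExp ha T).const_mul C).mono' hE.aestronglyMeasurable (ae_of_all _ hb)

lemma integrable_strip {a C T : ℝ} (ha : 0 < a) {E : ℝ × ℝ → ℂ} (hE : Continuous E)
    (hb : ∀ t, ∀ s ∈ Set.Icc 0 (2 * Real.pi * a), ‖E (t, s)‖ ≤ C * cutoffExp a T t) :
    Integrable E (stripMeasure a) := by
  refine Integrable.mono' (((integrable_cutoffExp ha T).const_mul C).comp_fst _)
    hE.aestronglyMeasurable ?_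
  filter_upwards [ae_mem_strip a] with p hp
  exact hb p.1 p.2 ⟨hp.2.1.le, hp.2.2⟩

/-- The integral over the strip of a `t`-derivative of a function vanishing at both ends. -/
lemma integral_strip_deriv_fst {a C T : ℝ} (ha : 0 < a) {G E : ℝ × ℝ → ℂ} (hE : Continuous E)
    (hd : ∀ t s, HasDerivAt (fun t => G (t, s)) (E (t, s)) t)
    (hG : ∀ t, ∀ s ∈ Set.Icc 0 (2 * Real.pi * a), ‖G (t, s)‖ ≤ C * cutoffExp a T t)
    (hb : ∀ t, ∀ s ∈ Set.Icc 0 (2 * Real.pi * a), ‖E (t, s)‖ ≤ C * cutoffExp a T t) :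
    ∫ p, E p ∂stripMeasure a = 0 := by
  have hi := integrable_strip ha hE hb
  rw [stripMeasure] at hi ⊢
  rw [integral_prod_symm _ hi]
  refine (setIntegral_congr_fun (g := fun _ => (0 : ℂ)) measurableSet_Ioc fun s hs => ?_).trans
    (by simp)
  have hs' : s ∈ Set.Icc 0 (2 * Real.pi * a) := ⟨hs.1.le, hs.2⟩
  have := integral_of_hasDerivAt_of_tendsto (fun t => hd t s)
    (integrable_slice ha (by fun_prop) fun t => hb t s hs')
    (squeeze_zero_norm (fun t => hG t s hs')
      (by simpa using (tendsto_cutoffExp_atBot ha T).const_mul C))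
    (squeeze_zero_norm (fun t => hG t s hs')
      (by simpa using (tendsto_cutoffExp_atTop a T).const_mul C))
  simpa using this

/-- The integral over the strip of an `s`-derivative is the difference of the boundary terms. -/
lemma integral_strip_deriv_snd {a C T : ℝ} (ha : 0 < a) {G E : ℝ × ℝ → ℂ} (hE : Continuous E)
    (hGc : Continuous G) (hd : ∀ t s, HasDerivAt (fun s => G (t, s)) (E (t, s)) s)
    (hG : ∀ t, ∀ s ∈ Set.Icc 0 (2 * Real.pi * a), ‖G (t, s)‖ ≤ C * cutoffExp a T t)
    (hb : ∀ t, ∀ s ∈ Set.Icc 0 (2 * Real.pi * a), ‖E (t, s)‖ ≤ C * cutoffExp a T t) :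
    ∫ p, E p ∂stripMeasure a =
      (∫ t, G (t, 2 * Real.pi * a)) - ∫ t, G (t, 0) := by
  have hp : 0 ≤ 2 * Real.pi * a := by positivity
  have hi := integrable_strip ha hE hb
  rw [stripMeasure] at hi ⊢
  rw [integral_prod _ hi, ← integral_sub
    (integrable_slice ha (by fun_prop) fun t => hG t _ (Set.right_mem_Icc.2 hp))
    (integrable_slice ha (by fun_prop) fun t => hG t _ (Set.left_mem_Icc.2 hp))]
  congr 1
  ext t
  rw [← intervalIntegral.integral_of_le hp]
  exact intervalIntegral.integral_eq_sub_of_hasDerivAt (fun s _ => hd t s)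
    (Continuous.intervalIntegrable (by fun_prop) _ _)

/-- The function `K e^{αζ} φ(e^ζ)`, `ζ = s + (a + i) t`, whose boundary values on the strip give
the vortex sheet. -/
def sheetFlux (a g : ℝ) (φ : ℂ → ℝ) (p : ℝ × ℝ) : ℂ :=
  amplitude a g * exp (growthExp a * spiralLog a p) * φ (exp (spiralLog a p))

/-- The derivative of `sheetFlux` in the direction in which `ζ` moves with velocity `c`. -/
def sheetFluxDeriv (a g : ℝ) (φ : ℂ → ℝ) (c : ℂ) (p : ℝ × ℝ) : ℂ :=
  amplitude a g * exp (growthExp a * spiralLog a p) *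
    (growthExp a * c * φ (exp (spiralLog a p)) +
      fderiv ℝ φ (exp (spiralLog a p)) (c * exp (spiralLog a p)))

lemma continuous_sheetFlux (a g : ℝ) {φ : ℂ → ℝ} (hφ : IsTest φ) :
    Continuous (sheetFlux a g φ) := by
  have := (spiralLog a).continuous
  have := hφ.1.continuous
  unfold sheetFlux
  fun_prop

lemma continuous_sheetFluxDeriv (a g : ℝ) {φ : ℂ → ℝ} (hφ : IsTest φ) (c : ℂ) :
    Continuous (sheetFluxDeriv a g φ c) := by
  have h1 := (spiralLog a).continuous
  have := hφ.1.continuous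
  have h2 : Continuous fun p => fderiv ℝ φ (exp (spiralLog a p)) (c * exp (spiralLog a p)) :=
    ((hφ.1.continuous_fderiv (by simp)).comp (continuous_exp.comp h1)).clm_apply
      (continuous_const.mul (continuous_exp.comp h1))
  unfold sheetFluxDeriv
  fun_prop

lemma hasDerivAt_sheetFlux (a g : ℝ) {φ : ℂ → ℝ} (hφ : IsTest φ) {γ : ℝ → ℝ × ℝ} {c : ℂ} {x : ℝ}
    (hγ : HasDerivAt (fun y => spiralLog a (γ y)) c x) :
    HasDerivAt (fun y => sheetFlux a g φ (γ y)) (sheetFluxDeriv a g φ c (γ x)) x := by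
  have h1 : HasDerivAt (fun y => exp (spiralLog a (γ y))) (exp (spiralLog a (γ x)) * c) x :=
    hγ.cexp
  have h2 : HasDerivAt (fun y => φ (exp (spiralLog a (γ y))))
      (fderiv ℝ φ (exp (spiralLog a (γ x))) (exp (spiralLog a (γ x)) * c)) x :=
    ((hφ.1.differentiable (by simp)).differentiableAt.hasFDerivAt).comp_hasDerivAt x h1
  convert! (((hγ.const_mul (growthExp a)).cexp).const_mul (amplitude a g)).mul h2.ofReal_comp using 1
  rw [sheetFluxDeriv, mul_comm c (exp _)]
  ring

/-- Both `sheetFlux` and its derivatives are dominated by a multiple of `cutoffExp`. -/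
lemma exists_sheetFlux_bound {a : ℝ} (ha : 0 < a) (g : ℝ) {φ : ℂ → ℝ} (hφ : IsTest φ) (c : ℂ) :
    ∃ C T, ∀ t, ∀ s ∈ Set.Icc 0 (2 * Real.pi * a),
      ‖sheetFlux a g φ (t, s)‖ ≤ C * cutoffExp a T t ∧
      ‖sheetFluxDeriv a g φ c (t, s)‖ ≤ C * cutoffExp a T t := by
  obtain ⟨R, hR0, hR⟩ := hφ.2.isCompact.isBounded.subset_closedBall_lt 0 0
  obtain ⟨M, hM⟩ := hφ.2.exists_bound_of_continuous hφ.1.continuous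
  obtain ⟨N, hN⟩ := (hφ.2.fderiv ℝ).exists_bound_of_continuous
    (hφ.1.continuous_fderiv (by simp))
  have hM0 : 0 ≤ M := (norm_nonneg _).trans (hM 0)
  have hN0 : 0 ≤ N := (norm_nonneg _).trans (hN 0)
  set B := ‖amplitude a g‖ * Real.exp (‖growthExp a‖ * (2 * Real.pi * a)) with hB
  have hB0 : 0 ≤ B := by positivity
  -- On the support of `φ` one has `s + at ≤ log R`, and `s ≥ 0` then gives `t ≤ log R / a`.
  refine ⟨B * (M + (‖growthExp a * c‖ * M + N * (‖c‖ * R))), Real.log R / a, fun t s hs => ?_⟩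
  have hamp : ‖amplitude a g * exp (growthExp a * spiralLog a (t, s))‖ ≤
      B * Real.exp (2 * a * t) := by
    rw [norm_mul, hB, mul_assoc]
    gcongr
    exact norm_exp_growthExp_mul_le t hs
  by_cases ht : t ≤ Real.log R / a ∧ exp (spiralLog a (t, s)) ∈ tsupport φ
  · have hz : ‖exp (spiralLog a (t, s))‖ ≤ R := by simpa using hR ht.2
    rw [cutoffExp, Set.indicator_of_mem (show t ∈ Set.Iic _ from ht.1)]
    constructor
    · rw [sheetFlux, norm_mul, norm_real]
      calc _ ≤ (B * Real.exp (2 * a * t)) * M := by gcongr; exact hM _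
        _ = B * M * Real.exp (2 * a * t) := by ring
        _ ≤ _ := by gcongr; exact le_add_of_nonneg_right (by positivity)
    · rw [sheetFluxDeriv, norm_mul]
      have h2 : ‖growthExp a * c * φ (exp (spiralLog a (t, s))) +
          (fderiv ℝ φ (exp (spiralLog a (t, s))) (c * exp (spiralLog a (t, s))) : ℝ)‖ ≤
          ‖growthExp a * c‖ * M + N * (‖c‖ * R) := by
        refine (norm_add_le _ _).trans (add_le_add ?_ ?_)
        · rw [norm_mul, norm_real]
          gcongr
          exact hM _
        · rw [norm_real]
          refine (ContinuousLinearMap.le_opNorm _ _).trans ?_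
          rw [norm_mul]
          gcongr
          exact hN _
      calc _ ≤ (B * Real.exp (2 * a * t)) * (‖growthExp a * c‖ * M + N * (‖c‖ * R)) := by gcongr
        _ = B * (‖growthExp a * c‖ * M + N * (‖c‖ * R)) * Real.exp (2 * a * t) := by ring
        _ ≤ _ := mul_le_mul_of_nonneg_right
          (mul_le_mul_of_nonneg_left (le_add_of_nonneg_left hM0) hB0) (Real.exp_nonneg _)
  · have hnot : exp (spiralLog a (t, s)) ∉ tsupport φ := by
      intro hmem
      refine ht ⟨?_, hmem⟩
      have hz : ‖exp (spiralLog a (t, s))‖ ≤ R := by simpa using hR hmem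
      rw [norm_exp_spiralLog, ← Real.le_log_iff_exp_le hR0] at hz
      rw [le_div_iff₀ ha]
      linarith [hs.1]
    have h0 : φ (exp (spiralLog a (t, s))) = 0 := image_eq_zero_of_notMem_tsupport hnot
    have h0' : fderiv ℝ φ (exp (spiralLog a (t, s))) = 0 :=
      image_eq_zero_of_notMem_tsupport fun h => hnot (tsupport_fderiv_subset ℝ h)
    have hnn : 0 ≤ cutoffExp a (Real.log R / a) t :=
      Set.indicator_nonneg (fun _ _ => Real.exp_nonneg _) _
    have : 0 ≤ B * (M + (‖growthExp a * c‖ * M + N * (‖c‖ * R))) *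
        cutoffExp a (Real.log R / a) t := by positivity
    simpa [sheetFlux, sheetFluxDeriv, h0, h0'] using this

lemma sheetPairing_eq (a g : ℝ) (φ : ℂ → ℝ) :
    sheetPairing a g φ = 2 * a * g * ∫ t, Real.exp (2 * a * t) * φ (Z a t) := by
  rw [sheetPairing, ← integral_const_mul]
  congr 1
  ext t
  have hd : deriv (Z a) t = Z a t * (a + I) := by
    have h : HasDerivAt (fun t : ℝ => ((a : ℂ) + I) * t) ((a + I) * 1) t :=
      (ofRealCLM.hasDerivAt (x := t)).const_mul _
    have := h.cexp.deriv
    rw [mul_one] at this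
    exact this
  have hn : ‖(a : ℂ) + I‖ = Real.sqrt (1 + a ^ 2) := by
    rw [norm_def, normSq_apply]
    congr 1
    simp
    ring
  have hs : Real.sqrt (1 + a ^ 2) ≠ 0 := by positivity
  rw [hd, norm_mul, hn, norm_Z, sheetDensity,
    show 2 * a * t = a * t + a * t by ring, Real.exp_add]
  field_simp

lemma spiralLog_two_pi_mul (a t : ℝ) :
    spiralLog a (t, 2 * Real.pi * a) = spiralLog a (t + 2 * Real.pi, 0) - 2 * Real.pi * I := by
  rw [spiralLog_apply, spiralLog_apply]
  push_cast
  ring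

/-- The edges `s = 2πa` and `s = 0` parametrize the same spiral with `t` shifted by `2π`. There `ζ`
differs by `2πi`, which `φ(e^ζ)` ignores and `e^{αζ}` sees as the monodromy. -/
lemma sheetFlux_two_pi_mul (a g : ℝ) (φ : ℂ → ℝ) (t : ℝ) :
    sheetFlux a g φ (t, 2 * Real.pi * a) = monodromy a * sheetFlux a g φ (t + 2 * Real.pi, 0) := by
  rw [sheetFlux, sheetFlux, spiralLog_two_pi_mul, Complex.exp_sub, exp_two_pi_mul_I, div_one,
    monodromy, expA_eq]
  have : exp (growthExp a * (spiralLog a (t + 2 * Real.pi, 0) - 2 * Real.pi * I)) =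
      exp (2 * Real.pi * (-I * growthExp a)) *
        exp (growthExp a * spiralLog a (t + 2 * Real.pi, 0)) := by
    rw [← Complex.exp_add]
    ring_nf
  rw [this]
  ring

lemma sheetFlux_zero (a g : ℝ) (φ : ℂ → ℝ) (t : ℝ) :
    sheetFlux a g φ (t, 0) = amplitude a g * (Real.exp (2 * a * t) * φ (Z a t) : ℝ) := by
  have h : growthExp a * spiralLog a (t, 0) = 2 * a * t := by
    rw [spiralLog_apply]
    push_cast
    linear_combination (t : ℂ) * growthExp_mul a
  rw [sheetFlux, h, exp_spiralLog]
  push_cast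
  rw [Complex.exp_zero, one_mul]
  ring

/-- The profile solves `div w = 0`, `curl w = γ δ_Σ` in the sense of distributions. -/
lemma integral_conj_profileField_mul_dbar {a : ℝ} (ha : 0 < a) (g : ℝ) {φ : ℂ → ℝ}
    (hφ : IsTest φ) :
    ∫ z, conj (profileField a g z) * (fderiv ℝ φ z 1 + I * fderiv ℝ φ z I) =
      I * sheetPairing a g φ := by
  obtain ⟨C₁, T₁, h₁⟩ := exists_sheetFlux_bound ha g hφ (a + I)
  obtain ⟨C₂, T₂, h₂⟩ := exists_sheetFlux_bound ha g hφ 1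
  have hc₁ := continuous_sheetFluxDeriv a g hφ (a + I)
  have hc₂ := continuous_sheetFluxDeriv a g hφ 1
  have hI₁ : ∫ p, sheetFluxDeriv a g φ (a + I) p ∂stripMeasure a = 0 := by
    refine integral_strip_deriv_fst ha (G := sheetFlux a g φ) hc₁ (fun t s => ?_)
      (fun t s hs => (h₁ t s hs).1) (fun t s hs => (h₁ t s hs).2)
    refine hasDerivAt_sheetFlux a g hφ (γ := fun t => (t, s)) ?_
    simp only [spiralLog_apply]
    simpa using ((ofRealCLM.hasDerivAt (x := t)).const_mul ((a : ℂ) + I)).const_add (s : ℂ)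
  have hI₂ : ∫ p, sheetFluxDeriv a g φ 1 p ∂stripMeasure a =
      (∫ t, sheetFlux a g φ (t, 2 * Real.pi * a)) - ∫ t, sheetFlux a g φ (t, 0) := by
    refine integral_strip_deriv_snd ha hc₂ (continuous_sheetFlux a g hφ) (fun t s => ?_)
      (fun t s hs => (h₂ t s hs).1) (fun t s hs => (h₂ t s hs).2)
    refine hasDerivAt_sheetFlux a g hφ (γ := fun s => (t, s)) ?_
    simp only [spiralLog_apply]
    simpa using (ofRealCLM.hasDerivAt (x := s)).add_const (((a : ℂ) + I) * t)
  -- The operator `∂_t - (a+i)∂_s` kills holomorphic functions of `ζ`, so in this combination of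
  -- total derivatives only the derivatives of `φ` remain.
  have hpt : ∀ᵐ p ∂(stripMeasure a), normSq (exp (spiralLog a p)) •
      (conj (profileField a g (exp (spiralLog a p))) *
        (fderiv ℝ φ (exp (spiralLog a p)) 1 + I * fderiv ℝ φ (exp (spiralLog a p)) I)) =
      I * sheetFluxDeriv a g φ (a + I) p - I * (a + I) * sheetFluxDeriv a g φ 1 p := by
    filter_upwards [ae_mem_strip a] with p hp
    obtain ⟨t, s⟩ := p
    rw [profileField_of_mem ha g t hp.2, conj_conj, sheetFluxDeriv, sheetFluxDeriv]
    set ζ := spiralLog a (t, s)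
    set D := fderiv ℝ φ (exp ζ)
    have hlin : ∀ w : ℂ, ((D w : ℝ) : ℂ) = w.re * D 1 + w.im * D I := by
      intro w
      have hw : w = w.re • (1 : ℂ) + w.im • I := by
        simp [re_add_im]
      conv_lhs => rw [hw, map_add, map_smul, map_smul]
      simp
    have hsplit : exp ((growthExp a - 1) * ζ) * exp ζ = exp (growthExp a * ζ) := by
      rw [← Complex.exp_add]; ring_nf
    rw [hlin (1 * exp ζ), hlin ((a + I) * exp ζ), real_smul, ← hsplit]
    have hnorm : ((normSq (exp ζ) : ℝ) : ℂ) = exp ζ * ((exp ζ).re - (exp ζ).im * I) := by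
      rw [← mul_conj]
      congr 1
      apply Complex.ext <;> simp
    rw [hnorm]
    simp only [one_mul, mul_re, mul_im, add_re, add_im, ofReal_re, ofReal_im, I_re, I_im]
    push_cast
    linear_combination (amplitude a g * exp ((growthExp a - 1) * ζ) * exp ζ *
      ((exp ζ).re * D 1)) * I_sq
  rw [integral_eq_integral_strip ha, integral_congr_ae hpt, integral_sub
    ((integrable_strip ha hc₁ fun t s hs => (h₁ t s hs).2).const_mul _)
    ((integrable_strip ha hc₂ fun t s hs => (h₂ t s hs).2).const_mul _),
    integral_const_mul, integral_const_mul, hI₁, hI₂]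
  simp only [sheetFlux_two_pi_mul]
  -- Translating `t` by `2π` puts both boundary integrals over the same edge; together they carry
  -- the factor `e^{2πA} - 1`, cancelled up to sign by the amplitude.
  rw [integral_const_mul, integral_add_right_eq_self (fun t => sheetFlux a g φ (t, 0)) (2 * Real.pi)]
  simp only [sheetFlux_zero]
  rw [integral_const_mul, integral_complex_ofReal, sheetPairing_eq, amplitude]
  have h1 := one_sub_monodromy_ne_zero ha
  have h2 := ofReal_add_I_ne_zero a
  push_cast
  field_simp
  ring

end PrandtlSpiral

end

/-! ### Assembly: uniqueness, then comparison with the explicit profile. -/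

theorem theorem1p1 (a g μ : ℝ) (ha : 0 < a) (hg : g ≠ 0) :
    (∀ w₁ w₂ : ℂ → ℂ, PrandtlSpiral.IsSpiralVelocity a g μ w₁ →
      PrandtlSpiral.IsSpiralVelocity a g μ w₂ → w₁ =ᵐ[volume] w₂) ∧
    (PrandtlSpiral.PressureMatching a g μ →
      ∀ w : ℂ → ℂ, PrandtlSpiral.IsSpiralVelocity a g μ w →
        ∀ᵐ z : ℂ, ∀ r θ : ℝ, 0 < r → z = r * Complex.exp (θ * Complex.I) →
          w z = PrandtlSpiral.prandtlProfile a g r θ) := by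
  refine ⟨fun w₁ w₂ h₁ h₂ => ?_, fun hp w hw => ?_⟩
  · exact PrandtlSpiral.ae_eq_of_matching ha h₁.locallyIntegrable h₂.locallyIntegrable
      (fun φ hφ => PrandtlSpiral.integral_conj_mul_dbar h₁.locallyIntegrable h₁.divFree h₁.curl_eq hφ)
      (fun φ hφ => PrandtlSpiral.integral_conj_mul_dbar h₂.locallyIntegrable h₂.divFree h₂.curl_eq hφ)
      h₁.matching h₂.matching
  · filter_upwards [PrandtlSpiral.ae_eq_of_matching ha hw.locallyIntegrable
      (PrandtlSpiral.locallyIntegrable_profileField ha g)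
      (fun φ hφ => PrandtlSpiral.integral_conj_mul_dbar hw.locallyIntegrable hw.divFree hw.curl_eq hφ)
      (fun φ hφ => PrandtlSpiral.integral_conj_profileField_mul_dbar ha g hφ)
      hw.matching (PrandtlSpiral.velocityMatching_profileField ha hp)] with z hz r θ hr hzr
    rw [hz, hzr, PrandtlSpiral.profileField_eq ha g hr]
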